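/- A \emph{negotiation diagram} $\mathcal N$ consists of a finite set $\mathit{Proc}$ of processes, a finite set $N$ of nodes, a set $R$ of outcomes, a non-empty set $\mathit{dom}(n)\subseteq \mathit{Proc}$ and a set $\mathit{out}(n)\subseteq R$ for each node $n$, a partial transition function $\delta$ giving a set $\delta(n,a,p)\subseteq N$ of nodes for all $n\in N$, $a\in \mathit{out}(n)$, $p\in\mathit{dom}(n)$, such that $p\in\mathit{dom}(n')$ for every $n'\in\delta(n,a,p)$, and two nodes $n_{\mathit{init}}$, $n_{\mathit{fin}}$ in which all processes participate; every node except possibly $n_{\mathit{fin}}$ has at least one outcome. $\mathcal N$ is \emph{deterministic} if every $\delta(n,a,p)$ is empty or a singleton. A \emph{location} is a pair $(n,a)$ with $a\in\mathit{out}(n)$; its domain is $\mathit{dom}(n)$. A \emph{configuration} is a map $C:\mathit{Proc}\to\mathcal P(N)$. A node $n$ is \emph{enabled} in $C$ if $n\in C(p)$ for all $p\in\mathit{dom}(n)$; then each location $(n,a)$ can be executed, leading to $C'$ with $C'(p)=\delta(n,a,p)$ for $p\in\mathit{dom}(n)$ and $C'(p)=C(p)$ otherwise. Write $C\xrightarrow{w}C'$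 if executing the finite sequence of locations $w$ from $C$ leads to $C'$. Let $C_{\mathit{init}}(p)=\{n_{\mathit{init}}\}$ and $C_{\mathit{fin}}(p)=\{n_{\mathit{fin}}\}$ for all $p$. A configuration $C$ is \emph{reachable} if $C_{\mathit{init}}\xrightarrow{w}C$ for some $w$, and a node is reachable if it is enabled in some reachable configuration. $\mathcal N$ is \emph{sound} if every finite run $C_{\mathit{init}}\xrightarrow{w}C$ can be completed to a run $C_{\mathit{init}}\xrightarrow{ww'}C_{\mathit{fin}}$. An \emph{$n$-sequence} is a finite sequence of locations whose domains are all included in $\mathit{dom}(n)$. \textbf{Theorem.} Let $\mathcal N$ be a sound deterministic negotiation diagram and let $n\neq n_{\mathit{fin}}$ be a reachable node of $\mathcal N$. Then: (1) there is a unique reachable configuration $I(n)$ that enables $n$ and no other node; (2) there is a unique configuration $F(n)$ that is reached from $I(n)$ by an $n$-sequence and that enables no node $m\ne n_{\mathit{fin}}$ with $\mathit{dom}(m)\subseteq\mathit{dom}(n)$; (3) the following \emph{subnegotiation} $\mathcal N|_n$ is a sound deterministic negotiation diagram. Its set of processes is $\mathit{dom}(n)$; its nodes and locations are those that appear in the $n$-sequences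 $u$ with $I(n)\xrightarrow{u}F(n)$, with the same domains as in $\mathcal N$, together with a new final node $n|^{\mathit{fin}}_n$ with domain $\mathit{dom}(n)$ and no outcome; its initial node is $n$; and its transition function is given, for each of its locations $(m,a)$ and each $p\in\mathit{dom}(m)$, by $$\delta|_n(m,a,p)=\begin{cases}\delta(m,a,p)&\text{if }\delta(m,a,p)\neq F(n)(p),\\ \{n|^{\mathit{fin}}_n\}&\text{if }\delta(m,a,p)=F(n)(p).\end{cases}$$ -/

import Mathlib

/-- A negotiation diagram with (finite) set of processes `P`, (finite) set of nodes `N` and set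
of outcomes `R`. A triple at which the partial transition function of the diagram is undefined
(because `a` is not an outcome of `n`, or because `p` does not take part in `n`) is given the
value `∅`. -/
structure NegotiationDiagram (P N R : Type*) [Finite P] [Finite N] where
  /-- the processes that participate in a node -/
  dom : N → Set P
  /-- the possible outcomes of a node -/
  out : N → Set R
  /-- `trans n a p`: the nodes in which `p` is ready to engage after outcome `a` of node `n` -/
  trans : N → R → P → Set N
  /-- the initial node -/
  init : N
  /-- the final node -/
  fin : N
  dom_nonempty : ∀ n, (dom n).Nonempty
  mem_trans : ∀ n a p n', n' ∈ trans n a p → a ∈ out n ∧ p ∈ dom n ∧ p ∈ dom n'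
  dom_init : dom init = Set.univ
  dom_fin : dom fin = Set.univ
  out_nonempty : ∀ n, n ≠ fin → (out n).Nonempty

namespace NegotiationDiagram

variable {P N R : Type*} [Finite P] [Finite N]

/-- Every set of successor nodes is empty or a singleton. -/
def Deterministic (D : NegotiationDiagram P N R) : Prop :=
  ∀ n a p, D.trans n a p = ∅ ∨ ∃ n', D.trans n a p = {n'}

/-- Node `n` is enabled in the configuration `C : P → Set N`. -/
def Enabled (D : NegotiationDiagram P N R) (C : P → Set N) (n : N) : Prop :=
  ∀ p ∈ D.dom n, n ∈ C p

open Classical in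
/-- The configuration produced by executing the location `(n, a)` in `C`. -/
noncomputable def fire (D : NegotiationDiagram P N R) (C : P → Set N) (n : N) (a : R) :
    P → Set N :=
  fun p => if p ∈ D.dom n then D.trans n a p else C p

/-- `D.Run C w C'`: the finite sequence `w` of locations can be executed from `C`, and it
leads to `C'`. -/
inductive Run (D : NegotiationDiagram P N R) :
    (P → Set N) → List (N × R) → (P → Set N) → Prop
  | nil (C : P → Set N) : Run D C [] C
  | cons {C C' : P → Set N} {n : N} {a : R} {w : List (N × R)} :
      D.Enabled C n → a ∈ D.out n → Run D (D.fire C n a) w C' → Run D C ((n, a) :: w) C'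

/-- The initial configuration. -/
def initConfig (D : NegotiationDiagram P N R) : P → Set N := fun _ => {D.init}

/-- The final configuration. -/
def finConfig (D : NegotiationDiagram P N R) : P → Set N := fun _ => {D.fin}

/-- Every finite run from the initial configuration can be completed to a successful run. -/
def Sound (D : NegotiationDiagram P N R) : Prop :=
  ∀ w C, D.Run D.initConfig w C → ∃ w', D.Run D.initConfig (w ++ w') D.finConfig

/-- `C` is reachable from the initial configuration. -/
def Reachable (D : NegotiationDiagram P N R) (C : P → Set N) : Prop :=
  ∃ w, D.Run D.initConfig w C

/-- Node `n` is enabled in some reachable configuration. -/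
def ReachableNode (D : NegotiationDiagram P N R) (n : N) : Prop :=
  ∃ C, D.Reachable C ∧ D.Enabled C n

/-- `w` is an `n`-sequence: the domains of all its locations are included in `dom n`. -/
def IsSeq (D : NegotiationDiagram P N R) (n : N) (w : List (N × R)) : Prop :=
  ∀ l ∈ w, D.dom l.1 ⊆ D.dom n

/-- `I` has the defining property of the configuration `I(n)`: it is reachable and enables `n`
and no other node. -/
def IsFirst (D : NegotiationDiagram P N R) (n : N) (I : P → Set N) : Prop :=
  D.Reachable I ∧ ∀ m, D.Enabled I m ↔ m = n

/-- `F` has the defining property of the configuration `F(n)`, relative to `I = I(n)`: it is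
reached from `I` by an `n`-sequence, and enables no node whose domain is included in `dom n`.
The final node is not counted as a node that can still be executed (this matters only if `n`
involves all processes, and then says that `F(n)` is the final configuration). -/
def IsLast (D : NegotiationDiagram P N R) (n : N) (I F : P → Set N) : Prop :=
  (∃ u, D.IsSeq n u ∧ D.Run I u F) ∧
    ∀ m, m ≠ D.fin → D.Enabled F m → ¬ D.dom m ⊆ D.dom n

/-- The locations that appear in the `n`-sequences leading from `I` to `F`. -/
def subLocs (D : NegotiationDiagram P N R) (n : N) (I F : P → Set N) : Set (N × R) :=
  {l | ∃ u, D.IsSeq n u ∧ D.Run I u F ∧ l ∈ u}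

/-- The nodes that appear in the `n`-sequences leading from `I` to `F`. -/
def subNodes (D : NegotiationDiagram P N R) (n : N) (I F : P → Set N) : Set N :=
  {m | ∃ a, (m, a) ∈ D.subLocs n I F}

theorem self_mem_subNodes (D : NegotiationDiagram P N R) {n : N} {I F : P → Set N}
    (hn : n ≠ D.fin) (hI : D.IsFirst n I) (hF : D.IsLast n I F) :
    n ∈ D.subNodes n I F := by
  obtain ⟨⟨u, hu, hr⟩, hmax⟩ := hF
  cases hr with
  | nil => exact absurd subset_rfl (hmax n hn ((hI.2 n).2 rfl))
  | @cons _ _ m a w he ha hw =>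
    obtain rfl := (hI.2 m).1 he
    exact ⟨a, _, hu, Run.cons he ha hw, by simp⟩

/-- The subnegotiation `D|_n`, where `I = I(n)` and `F = F(n)`. Its processes are those of
`dom n`, its nodes and locations are those that appear in the `n`-sequences leading from `I` to
`F`, and `none` is the new final node. -/
def subnegotiation (D : NegotiationDiagram P N R) (n : N) (I F : P → Set N)
    (hn : n ≠ D.fin) (hI : D.IsFirst n I) (hF : D.IsLast n I F) :
    NegotiationDiagram {p : P // p ∈ D.dom n} (Option {m : N // m ∈ D.subNodes n I F}) R where
  dom
    | none => Set.univ
    | some m => {p | p.1 ∈ D.dom m.1}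
  out
    | none => ∅
    | some m => {a | (m.1, a) ∈ D.subLocs n I F}
  trans
    | none, _, _ => ∅
    | some m, a, p =>
      {k | (m.1, a) ∈ D.subLocs n I F ∧ p.1 ∈ D.dom m.1 ∧
        ((D.trans m.1 a p.1 ≠ F p.1 ∧ ∃ m', k = some m' ∧ m'.1 ∈ D.trans m.1 a p.1) ∨
          (D.trans m.1 a p.1 = F p.1 ∧ k = none))}
  init := some ⟨n, D.self_mem_subNodes hn hI hF⟩
  fin := none
  dom_nonempty := by
    rintro (_ | ⟨m, hm⟩)
    · obtain ⟨p, hp⟩ := D.dom_nonempty n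
      exact ⟨⟨p, hp⟩, trivial⟩
    · obtain ⟨p, hp⟩ := D.dom_nonempty m
      obtain ⟨a, u, hu, -, hmem⟩ := hm
      exact ⟨⟨p, hu _ hmem hp⟩, hp⟩
  mem_trans := by
    rintro (_ | m) a p k hk
    · exact hk.elim
    · obtain ⟨h1, h2, ⟨-, m', rfl, hm'⟩ | ⟨-, rfl⟩⟩ := hk
      · exact ⟨h1, h2, (D.mem_trans _ _ _ _ hm').2.2⟩
      · exact ⟨h1, h2, trivial⟩
  dom_init := by
    ext p
    simp
  dom_fin := rfl
  out_nonempty := by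
    rintro (_ | ⟨m, hm⟩) h
    · exact absurd rfl h
    · exact hm

theorem Run.exists_mem_or_eq {D : NegotiationDiagram P N R} {C C' : P → Set N}
    {w : List (N × R)} (h : D.Run C w C') (p : P) :
    (∃ l ∈ w, l.1 ∈ C p) ∨ C' p = C p := by
  induction h with
  | nil => exact Or.inr rfl
  | @cons C C' n a w he ha hw ih =>
    by_cases hp : p ∈ D.dom n
    · exact Or.inl ⟨(n, a), by simp, he p hp⟩
    · have hC : D.fire C n a p = C p := by simp [fire, hp]
      rw [hC] at ih
      rcases ih with ⟨l, hl, hm⟩ | h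
      · exact Or.inl ⟨l, List.mem_cons_of_mem _ hl, hm⟩
      · exact Or.inr h

theorem Run.exists_mem_or_trans_eq {D : NegotiationDiagram P N R} {C C' : P → Set N}
    {w : List (N × R)} (h : D.Run C w C') {m : N} {a : R} (hm : (m, a) ∈ w) {p : P}
    (hp : p ∈ D.dom m) : (∃ l ∈ w, l.1 ∈ D.trans m a p) ∨ C' p = D.trans m a p := by
  induction h with
  | nil => simp at hm
  | @cons C C' n b w he hb hw ih =>
    rcases List.mem_cons.1 hm with heq | hm
    · obtain ⟨rfl, rfl⟩ := Prod.mk.inj heq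
      have hC : D.fire C m a p = D.trans m a p := by simp [fire, hp]
      rcases hw.exists_mem_or_eq p with ⟨l, hl, hx⟩ | h
      · exact Or.inl ⟨l, List.mem_cons_of_mem _ hl, hC ▸ hx⟩
      · exact Or.inr (h.trans hC)
    · rcases ih hm with ⟨l, hl, hx⟩ | h
      · exact Or.inl ⟨l, List.mem_cons_of_mem _ hl, hx⟩
      · exact Or.inr h

/-- In a deterministic diagram, a transition of `D|_n` that is not redirected to the new final
node leads to nodes of `D|_n`: restricting it to these nodes loses nothing. -/
theorem trans_subset_subNodes (D : NegotiationDiagram P N R) (hD : D.Deterministic) {n : N}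
    {I F : P → Set N} {m : N} {a : R} {p : P} (hl : (m, a) ∈ D.subLocs n I F)
    (hp : p ∈ D.dom m) (hne : D.trans m a p ≠ F p) :
    D.trans m a p ⊆ D.subNodes n I F := by
  obtain ⟨u, hu, hr, hmem⟩ := hl
  rcases hr.exists_mem_or_trans_eq hmem hp with ⟨⟨k, b⟩, hl, hx⟩ | h
  · intro m' hm'
    rcases hD m a p with h0 | ⟨k', hk⟩
    · simp [h0] at hm'
    · rw [hk] at hm' hx
      simp only [Set.mem_singleton_iff] at hm' hx
      obtain rfl : m' = k := hm'.trans hx.symm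
      exact ⟨b, u, hu, hr, hl⟩
  · exact absurd h.symm hne

end NegotiationDiagram

/-! Existence of I(n) and F(n): in a deterministic diagram, distinct nodes enabled in a reachable
configuration have disjoint domains, so an enabled node can be moved to the front of a completing
run. Executing nodes of a given set with the outcomes so obtained shortens that run, hence stops
(`Reachable.exists_exhaust`).

Uniqueness rests on `Covered.eq`: two reachable configurations coincide if each node enabled in one
is awaited by some process in the other. The tool is a `Guide`, a strategy that steers one token to
the final node, the token possibly changing its carrier at each node. Soundness allows only one
token per guide (`Guide.eq_of_mem`), and `Covered` bounds how far ahead it can be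
(`Guide.not_rank_lt`). Processes outside dom(n) are not moved by n-sequences, so the candidates for
I(n), and those for F(n), cover each other.

The same criterion shows that no process waits in F(n) at a non-final node executed in an n-sequence
(`IsLast.notMem`). Comparing positions with F(n) thus tells which processes have finished, and runs
of the subnegotiation correspond to n-sequences that can be continued to F(n). -/

namespace NegotiationDiagram

/-! ### Runs, commutation of enabled nodes, exhausting a set of nodes -/

section Runs

variable {P N R : Type*} [Finite P] [Finite N] {D : NegotiationDiagram P N R}

theorem fire_of_mem {C : P → Set N} {n : N} {a : R} {p : P} (hp : p ∈ D.dom n) :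
    D.fire C n a p = D.trans n a p := by simp [fire, hp]

theorem fire_of_notMem {C : P → Set N} {n : N} {a : R} {p : P} (hp : p ∉ D.dom n) :
    D.fire C n a p = C p := by simp [fire, hp]

theorem Run.append {C C' C'' : P → Set N} {u v : List (N × R)} (h : D.Run C u C')
    (h' : D.Run C' v C'') : D.Run C (u ++ v) C'' := by
  induction h with
  | nil => exact h'
  | cons he ha _ ih => exact .cons he ha (ih h')

theorem Run.of_append {C C' C'' : P → Set N} {u v : List (N × R)} (h : D.Run C u C')
    (h' : D.Run C (u ++ v) C'') : D.Run C' v C'' := by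
  induction h with
  | nil => exact h'
  | cons _ _ _ ih =>
    cases h' with
    | cons _ _ h'' => exact ih h''

theorem Run.single {C : P → Set N} {n : N} {a : R} (he : D.Enabled C n) (ha : a ∈ D.out n) :
    D.Run C [(n, a)] (D.fire C n a) := .cons he ha (.nil _)

theorem Run.mem_out {C C' : P → Set N} {w : List (N × R)} (h : D.Run C w C') {n : N} {a : R}
    (hw : (n, a) ∈ w) : a ∈ D.out n := by
  induction h with
  | nil => simp at hw
  | cons _ hb _ ih =>
    rcases List.mem_cons.1 hw with h | h
    · cases h
      exact hb
    · exact ih h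

theorem Reachable.run {C C' : P → Set N} {w : List (N × R)} (hC : D.Reachable C)
    (h : D.Run C w C') : D.Reachable C' := by
  obtain ⟨u, hu⟩ := hC
  exact ⟨u ++ w, hu.append h⟩

theorem Reachable.fire {C : P → Set N} {n : N} {a : R} (hC : D.Reachable C)
    (he : D.Enabled C n) (ha : a ∈ D.out n) : D.Reachable (D.fire C n a) :=
  hC.run (Run.single he ha)

theorem Run.subsingleton (hdet : D.Deterministic) {C C' : P → Set N} {w : List (N × R)}
    (h : D.Run C w C') (hC : ∀ p, (C p).Subsingleton) (p : P) : (C' p).Subsingleton := by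
  induction h with
  | nil => exact hC p
  | @cons C C' n a w he ha hw ih =>
    refine ih fun q => ?_
    by_cases hq : q ∈ D.dom n
    · rw [fire_of_mem hq]
      rcases hdet n a q with h0 | ⟨k, hk⟩
      · simp [h0]
      · simp [hk]
    · rw [fire_of_notMem hq]
      exact hC q

theorem Reachable.eq (hdet : D.Deterministic) {C : P → Set N} (hC : D.Reachable C) {p : P}
    {m m' : N} (hm : m ∈ C p) (hm' : m' ∈ C p) : m = m' := by
  obtain ⟨w, hw⟩ := hC
  exact hw.subsingleton hdet (fun _ => Set.subsingleton_singleton) p hm hm'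

theorem Reachable.exists_run (hsound : D.Sound) {C : P → Set N} (hC : D.Reachable C) :
    ∃ w, D.Run C w D.finConfig := by
  obtain ⟨u, hu⟩ := hC
  obtain ⟨w, hw⟩ := hsound u C hu
  exact ⟨w, hu.of_append hw⟩

theorem Reachable.eq_finConfig (hdet : D.Deterministic) {C : P → Set N} (hC : D.Reachable C)
    (h : D.Enabled C D.fin) : C = D.finConfig := by
  funext p
  have hp : D.fin ∈ C p := h p (by simp [D.dom_fin])
  ext m
  exact ⟨fun hm => hC.eq hdet hm hp, fun hm => by obtain rfl : m = D.fin := hm; exact hp⟩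

theorem Reachable.exists_enabled (hdet : D.Deterministic) (hsound : D.Sound) {C : P → Set N}
    (hC : D.Reachable C) (h : C ≠ D.finConfig) : ∃ m, m ≠ D.fin ∧ D.Enabled C m := by
  obtain ⟨w, hw⟩ := hC.exists_run hsound
  cases hw with
  | nil => exact absurd rfl h
  | @cons _ _ m a w he ha hw =>
    exact ⟨m, fun hm => h (hC.eq_finConfig hdet (hm ▸ he)), he⟩

/-- Distinct nodes that are enabled in a reachable configuration have disjoint domains. -/
theorem Reachable.notMem_dom (hdet : D.Deterministic) {C : P → Set N} (hC : D.Reachable C)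
    {m x : N} (hm : D.Enabled C m) (hx : D.Enabled C x) (hne : m ≠ x) {p : P}
    (hp : p ∈ D.dom m) : p ∉ D.dom x :=
  fun hp' => hne (hC.eq hdet (hm p hp) (hx p hp'))

/-- A process waiting at `m` is not moved when another node is executed. -/
theorem Reachable.mem_fire (hdet : D.Deterministic) {C : P → Set N} (hC : D.Reachable C)
    {m x : N} {a : R} {p : P} (hm : m ∈ C p) (hx : D.Enabled C x) (hne : m ≠ x) :
    m ∈ D.fire C x a p := by
  rwa [fire_of_notMem fun hp => hne (hC.eq hdet hm (hx p hp))]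

theorem Reachable.enabled_run (hdet : D.Deterministic) {C C' : P → Set N} {u : List (N × R)}
    (hC : D.Reachable C) (h : D.Run C u C') {m : N} (hm : D.Enabled C m)
    (hu : ∀ l ∈ u, l.1 ≠ m) : D.Enabled C' m := by
  induction h with
  | nil => exact hm
  | cons he ha _ ih =>
    exact ih (hC.fire he ha)
      (fun p hp => hC.mem_fire hdet (hm p hp) he (hu _ List.mem_cons_self).symm)
      fun l hl => hu l (List.mem_cons_of_mem _ hl)

theorem fire_comm {C : P → Set N} {m x : N} {a b : R}
    (h : ∀ p ∈ D.dom m, p ∉ D.dom x) :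
    D.fire (D.fire C x a) m b = D.fire (D.fire C m b) x a := by
  funext p
  by_cases hm : p ∈ D.dom m
  · rw [fire_of_mem hm, fire_of_notMem (h p hm), fire_of_mem hm]
  · by_cases hx : p ∈ D.dom x
    · rw [fire_of_notMem hm, fire_of_mem hx, fire_of_mem hx]
    · rw [fire_of_notMem hm, fire_of_notMem hx, fire_of_notMem hx, fire_of_notMem hm]

/-- An enabled node can be moved to the front of a run to the final configuration. -/
theorem Reachable.exists_run_fire (hdet : D.Deterministic) {m : N} (hmf : m ≠ D.fin)
    (w : List (N × R)) : ∀ {C : P → Set N}, D.Reachable C → D.Enabled C m →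
      D.Run C w D.finConfig → ∃ b w', b ∈ D.out m ∧ D.Run (D.fire C m b) w' D.finConfig ∧
        w'.length < w.length := by
  induction w with
  | nil =>
    intro C _ hm h
    cases h
    obtain ⟨p, hp⟩ := D.dom_nonempty m
    exact absurd (hm p hp) hmf
  | cons l w ih =>
    intro C hC hm h
    cases h with
    | @cons _ _ x a _ he ha h =>
      by_cases hx : m = x
      · subst hx
        -- The location of `m` is consumed here, which makes the remaining run strictly shorter.
        exact ⟨a, w, ha, h, by simp⟩
      · have hd : ∀ p ∈ D.dom m, p ∉ D.dom x := fun p hp => hC.notMem_dom hdet hm he hx hp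
        obtain ⟨b, w', hb, hr, hl⟩ := ih (hC.fire he ha)
          (fun p hp => hC.mem_fire hdet (hm p hp) he hx) h
        rw [fire_comm hd] at hr
        exact ⟨b, (x, a) :: w', hb,
          .cons (fun p hp => hC.mem_fire hdet (he p hp) hm (Ne.symm hx)) ha hr, by simpa using hl⟩

/-- Nodes from a given set of non-final nodes can be executed until none of them is enabled. -/
theorem Reachable.exists_exhaust (hdet : D.Deterministic) (hsound : D.Sound) (Q : Set N)
    (hQ : D.fin ∉ Q) {C : P → Set N} (hC : D.Reachable C) :
    ∃ u C', D.Run C u C' ∧ (∀ l ∈ u, l.1 ∈ Q) ∧ ∀ m ∈ Q, ¬ D.Enabled C' m := by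
  obtain ⟨w, hw⟩ := hC.exists_run hsound
  -- The outcome `b` is provided by the completing run, so that this run gets shorter; arbitrary
  -- outcomes could loop forever.
  induction hk : w.length using Nat.strong_induction_on generalizing C w with
  | _ k ih =>
    by_cases h : ∃ m ∈ Q, D.Enabled C m
    · obtain ⟨m, hm, he⟩ := h
      obtain ⟨b, w', hb, hr, hl⟩ :=
        Reachable.exists_run_fire hdet (fun h => hQ (h ▸ hm)) w hC he hw
      obtain ⟨u, C', hu, huQ, hmax⟩ := ih _ (hk ▸ hl) (hC.fire he hb) w' hr rfl
      refine ⟨(m, b) :: u, C', .cons he hb hu, ?_, hmax⟩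
      simpa [hm] using huQ
    · push Not at h
      exact ⟨[], C, .nil C, by simp, h⟩

theorem IsSeq.eq_of_notMem {n : N} {C C' : P → Set N} {u : List (N × R)} (hu : D.IsSeq n u)
    (h : D.Run C u C') {p : P} (hp : p ∉ D.dom n) : C' p = C p := by
  induction h with
  | nil => rfl
  | cons _ _ _ ih =>
    rw [ih fun l hl => hu l (List.mem_cons_of_mem _ hl)]
    exact fire_of_notMem fun h => hp (hu _ List.mem_cons_self h)

theorem IsSeq.append {n : N} {u v : List (N × R)} (hu : D.IsSeq n u) (hv : D.IsSeq n v) :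
    D.IsSeq n (u ++ v) :=
  fun l hl => (List.mem_append.1 hl).elim (hu l) (hv l)

end Runs

/-! ### Guides: steering a single token to the final node -/

section Guides

variable {P N R : Type*} [Finite P] [Finite N]

/-- A choice of outcomes `outcome m` for some nodes `m` that passes a token from the process
`entry m` to the process `entry (next m)`, and brings it closer to the final node. -/
structure Guide (D : NegotiationDiagram P N R) where
  /-- the nodes of the guide -/
  nodes : Set N
  /-- the process that carries the token to a node -/
  entry : N → P
  /-- the outcome that passes the token on -/
  outcome : N → R
  /-- the node that the token reaches next -/
  next : N → N
  /-- a bound for the distance to the final node -/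
  rank : N → ℕ
  entry_mem : ∀ m ∈ nodes, entry m ∈ D.dom m
  next_mem : ∀ m ∈ nodes, m ≠ D.fin → next m ∈ nodes
  rank_next : ∀ m ∈ nodes, m ≠ D.fin → rank (next m) < rank m
  next_mem_trans : ∀ m ∈ nodes, m ≠ D.fin → next m ∈ D.trans m (outcome m) (entry (next m))

/-- Every process of `m` can be taken as the start of a guide. -/
def Guided (D : NegotiationDiagram P N R) (m : N) : Prop :=
  ∀ p ∈ D.dom m, ∃ G : D.Guide, m ∈ G.nodes ∧ G.entry m = p

variable {D : NegotiationDiagram P N R}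

theorem guided_fin [Nonempty R] : D.Guided D.fin := fun p hp =>
  ⟨{ nodes := {D.fin}
     entry := fun _ => p
     -- A dummy value: the conditions on outcomes exclude the final node.
     outcome := fun _ => Classical.arbitrary R
     next := id
     rank := fun _ => 0
     entry_mem := by rintro _ rfl; exact hp
     next_mem := fun _ h h' => absurd h h'
     rank_next := fun _ h h' => absurd h h'
     next_mem_trans := fun _ h h' => absurd h h' }, rfl, rfl⟩

-- Keep only `m` and the nodes of smaller rank. No remaining node passes the token to `m`, so the
-- carrier at `m` can be changed freely.
open Classical in
theorem Guide.exists_entry_eq (G : D.Guide) {m : N} (hm : m ∈ G.nodes) {p : P}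
    (hp : p ∈ D.dom m) : ∃ G : D.Guide, m ∈ G.nodes ∧ G.entry m = p := by
  refine ⟨{ nodes := {x | x = m ∨ x ∈ G.nodes ∧ G.rank x < G.rank m}
            entry := Function.update G.entry m p
            outcome := G.outcome
            next := G.next
            rank := G.rank
            entry_mem := ?_
            next_mem := ?_
            rank_next := ?_
            next_mem_trans := ?_ }, Or.inl rfl, by simp⟩
  · rintro x (rfl | ⟨hx, hlt⟩)
    · simpa using hp
    · rw [Function.update_of_ne (by rintro rfl; exact lt_irrefl _ hlt)]
      exact G.entry_mem x hx
  · rintro x (rfl | ⟨hx, hlt⟩) hf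
    · exact Or.inr ⟨G.next_mem x hm hf, G.rank_next x hm hf⟩
    · exact Or.inr ⟨G.next_mem x hx hf, (G.rank_next x hx hf).trans hlt⟩
  · rintro x (rfl | ⟨hx, hlt⟩) hf
    · exact G.rank_next x hm hf
    · exact G.rank_next x hx hf
  · intro x hx' hf
    have hx : x ∈ G.nodes ∧ G.rank x ≤ G.rank m := by
      rcases hx' with rfl | ⟨hx, hlt⟩
      · exact ⟨hm, le_rfl⟩
      · exact ⟨hx, hlt.le⟩
    have hlt := (G.rank_next x hx.1 hf).trans_le hx.2
    rw [Function.update_of_ne fun h => by simp [h] at hlt]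
    exact G.next_mem_trans x hx.1 hf

-- A token arriving at `m` with any process is handed over to `r`, from where a guide starting at
-- `m'` with entry `r` takes it on.
open Classical in
theorem Guided.of_trans {m m' : N} {a : R} {r : P} (h : D.Guided m') (hm : m ≠ D.fin)
    (hr : m' ∈ D.trans m a r) : D.Guided m := by
  intro p hp
  obtain ⟨G, hG, rfl⟩ := h r (D.mem_trans _ _ _ _ hr).2.2
  by_cases hmG : m ∈ G.nodes
  · exact G.exists_entry_eq hmG hp
  have hne {x : N} (hx : x ∈ G.nodes) : x ≠ m := by rintro rfl; exact hmG hx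
  refine ⟨{ nodes := {x | x = m ∨ x ∈ G.nodes ∧ G.rank x ≤ G.rank m'}
            entry := Function.update G.entry m p
            outcome := Function.update G.outcome m a
            next := Function.update G.next m m'
            rank := Function.update G.rank m (G.rank m' + 1)
            entry_mem := ?_
            next_mem := ?_
            rank_next := ?_
            next_mem_trans := ?_ }, Or.inl rfl, by simp⟩
  · rintro x (rfl | ⟨hx, hle⟩)
    · simpa using hp
    · rw [Function.update_of_ne (hne hx)]
      exact G.entry_mem x hx
  · rintro x (rfl | ⟨hx, hle⟩) hf
    · exact Or.inr (by simpa using hG)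
    · rw [Function.update_of_ne (hne hx)]
      exact Or.inr ⟨G.next_mem x hx hf, (G.rank_next x hx hf).le.trans hle⟩
  · rintro x (rfl | ⟨hx, hle⟩) hf
    · simp [Function.update_of_ne (hne hG)]
    · rw [Function.update_of_ne (hne hx), Function.update_of_ne (hne hx),
        Function.update_of_ne (hne (G.next_mem x hx hf))]
      exact G.rank_next x hx hf
  · rintro x (rfl | ⟨hx, hle⟩) hf
    · simpa [Function.update_of_ne (hne hG)] using hr
    · rw [Function.update_of_ne (hne hx), Function.update_of_ne (hne hx),
        Function.update_of_ne (hne (G.next_mem x hx hf))]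
      exact G.next_mem_trans x hx hf

/-- Backward induction along a completing run: when `m` is executed, its processes move to nodes
already known to be guided. A process with no successor node could never reach the final node. -/
theorem Reachable.guided (hdet : D.Deterministic) (hsound : D.Sound) [Nonempty R]
    {C : P → Set N} (hC : D.Reachable C) {p : P} {m : N} (hm : m ∈ C p) : D.Guided m := by
  obtain ⟨w, hw⟩ := hC.exists_run hsound
  induction w generalizing C p m with
  | nil =>
    cases hw
    obtain rfl : m = D.fin := hm
    exact guided_fin
  | cons l w ih =>
    cases hw with
    | @cons _ _ x a _ he ha hw =>
      by_cases hf : m = D.fin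
      · exact hf ▸ guided_fin
      have hC' := hC.fire he ha
      by_cases hx : m = x
      · subst hx
        obtain ⟨q, hq⟩ := D.dom_nonempty m
        have hne : ((D.fire C m a) q).Nonempty := by
          by_contra h
          obtain ⟨v, hv⟩ := hC'.exists_run hsound
          rcases hv.exists_mem_or_eq q with ⟨l, -, hl⟩ | h'
          · exact h ⟨_, hl⟩
          · exact h (h' ▸ Set.singleton_nonempty _)
        obtain ⟨k, hk⟩ := hne
        exact (ih hC' hk hw).of_trans hf (by rwa [fire_of_mem hq] at hk)
      · exact ih hC' (hC.mem_fire hdet hm he hx) hw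

/-- If the node `m` of a guide is enabled, the outcome given by the guide passes the token on. -/
theorem Guide.next_mem_fire (G : D.Guide) {C : P → Set N} {m : N} (hm : m ∈ G.nodes)
    (hf : m ≠ D.fin) : G.next m ∈ D.fire C m (G.outcome m) (G.entry (G.next m)) := by
  have h := G.next_mem_trans m hm hf
  rwa [fire_of_mem (D.mem_trans _ _ _ _ h).2.1]

theorem Guide.outcome_mem (G : D.Guide) {m : N} (hm : m ∈ G.nodes) (hf : m ≠ D.fin) :
    G.outcome m ∈ D.out m :=
  (D.mem_trans _ _ _ _ (G.next_mem_trans m hm hf)).1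

/-- In a reachable configuration, there is at most one token on a guide. -/
theorem Guide.eq_of_mem (G : D.Guide) (hdet : D.Deterministic) (hsound : D.Sound)
    {C : P → Set N} (hC : D.Reachable C) {m m' : N} (hm : m ∈ G.nodes) (hm' : m' ∈ G.nodes)
    (h : m ∈ C (G.entry m)) (h' : m' ∈ C (G.entry m')) : m = m' := by
  induction hk : G.rank m + G.rank m' using Nat.strong_induction_on generalizing C m m' with
  | _ k ih =>
    by_contra hne
    have key : ∀ (C : P → Set N) (m m' : N), D.Reachable C → m ∈ G.nodes → m' ∈ G.nodes →
        m' ∈ C (G.entry m') → m ≠ m' → D.Enabled C m → G.rank m + G.rank m' = k → False := by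
      intro C m m' hC hm hm' h' hne he hk
      have hf : m ≠ D.fin := by
        rintro rfl
        rw [hC.eq_finConfig hdet he] at h'
        exact hne h'.symm
      have hlt := G.rank_next m hm hf
      have heq := ih _ (by omega) (hC.fire he (G.outcome_mem hm hf)) (G.next_mem m hm hf) hm'
        (G.next_mem_fire hm hf) (hC.mem_fire hdet h' he (Ne.symm hne)) rfl
      -- The new carrier takes part in `m`; if it is also the carrier at `m'`, it waits at both
      -- nodes in `C`.
      have hd := (D.mem_trans _ _ _ _ (G.next_mem_trans m hm hf)).2.1
      rw [heq] at hd
      exact hne (hC.eq hdet (he _ hd) h')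
    obtain ⟨w, hw⟩ := hC.exists_run hsound
    clear ih
    -- Follow the completing run until `m` or `m'` is executed; there `key` deviates from it with
    -- the outcome of the guide.
    induction w generalizing C with
    | nil =>
      cases hw
      exact hne (h.trans h'.symm)
    | cons l w ihw =>
      cases hw with
      | @cons _ _ x a _ he ha hw =>
        by_cases hx : m = x
        · exact key C m m' hC hm hm' h' hne (hx ▸ he) hk
        by_cases hx' : m' = x
        · exact key C m' m hC hm' hm h (Ne.symm hne) (hx' ▸ he) (by omega)
        exact ihw (hC.fire he ha) (hC.mem_fire hdet h he hx) (hC.mem_fire hdet h' he hx') hw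

/-! ### Comparing reachable configurations by the nodes they enable -/

/-- Every node enabled in `C` is awaited by some process in `C'`. -/
def Covered (D : NegotiationDiagram P N R) (C C' : P → Set N) : Prop :=
  ∀ y, D.Enabled C y → ∃ q ∈ D.dom y, y ∈ C' q

/-- Only processes waiting at `x` move, and `x` is not among the nodes to be awaited. -/
theorem Covered.fire_right (hdet : D.Deterministic) {C C' : P → Set N} (h : D.Covered C C')
    (hC' : D.Reachable C') {x : N} {a : R} (hx : D.Enabled C' x) (hx' : ¬ D.Enabled C x) :
    D.Covered C (D.fire C' x a) := by
  intro y hy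
  obtain ⟨q, hq, hyq⟩ := h y hy
  exact ⟨q, hq, hC'.mem_fire hdet hyq hx (by rintro rfl; exact hx' hy)⟩

/-- If `y` shares a process with `x`, that process is sent to the same place on both sides;
otherwise `y` was enabled before. -/
theorem Covered.fire {C C' : P → Set N} (h : D.Covered C C') (x : N) (a : R) :
    D.Covered (D.fire C x a) (D.fire C' x a) := by
  intro y hy
  by_cases hs : ∃ s ∈ D.dom y, s ∈ D.dom x
  · obtain ⟨s, hs, hsx⟩ := hs
    have := hy s hs
    rw [fire_of_mem hsx] at this
    exact ⟨s, hs, by rwa [fire_of_mem hsx]⟩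
  · push Not at hs
    obtain ⟨q, hq, hyq⟩ := h y fun p hp => by
      have := hy p hp
      rwa [fire_of_notMem (hs p hp)] at this
    exact ⟨q, hq, by rwa [fire_of_notMem (hs q hq)]⟩

theorem Covered.eq_finConfig (hdet : D.Deterministic) (hsound : D.Sound) {C : P → Set N}
    (hC : D.Reachable C) (h : D.Covered C D.finConfig) : C = D.finConfig := by
  by_contra hne
  obtain ⟨y, hy, he⟩ := hC.exists_enabled hdet hsound hne
  obtain ⟨q, -, hq⟩ := h y he
  exact hy hq

/-- If every node enabled in `C` is awaited in `C'`, the token of a guide is not further ahead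
in `C'` than in `C`. -/
theorem Guide.not_rank_lt (G : D.Guide) (hdet : D.Deterministic) (hsound : D.Sound)
    {C C' : P → Set N} (hC : D.Reachable C) (hC' : D.Reachable C') (hcov : D.Covered C C')
    {z m : N} (hz : z ∈ G.nodes) (hm : m ∈ G.nodes) (hzC : z ∈ C (G.entry z))
    (hmC : m ∈ C' (G.entry m)) : ¬ G.rank m < G.rank z := by
  induction hk : G.rank m using Nat.strong_induction_on generalizing C C' m with
  | _ k ih =>
    intro hlt
    have hne : m ≠ z := by rintro rfl; omega
    obtain ⟨w, hw⟩ := hC'.exists_run hsound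
    induction w generalizing C C' with
    | nil =>
      cases hw
      rw [Covered.eq_finConfig hdet hsound hC hcov] at hzC
      exact hne (hmC.trans hzC.symm)
    | cons l w ihw =>
      -- The final node may have outcomes, so the run can pass through the final configuration;
      -- stopping there gives `x ≠ D.fin`.
      by_cases hf' : C' = D.finConfig
      · subst hf'
        rw [Covered.eq_finConfig hdet hsound hC hcov] at hzC
        exact hne (hmC.trans hzC.symm)
      cases hw with
      | @cons _ _ x a _ he ha hw =>
        have hf : x ≠ D.fin := by
          rintro rfl
          exact hf' (hC'.eq_finConfig hdet he)
        by_cases hx : D.Enabled C x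
        · have hxz : z ≠ x := by
            rintro rfl
            exact hne (G.eq_of_mem hdet hsound hC' hm hz hmC (he _ (G.entry_mem z hz)))
          have hxm : m ≠ x := by
            rintro rfl
            exact hne (G.eq_of_mem hdet hsound hC hm hz (hx _ (G.entry_mem m hm)) hzC)
          exact ihw (hC.fire hx ha) (hC'.fire he ha) (hcov.fire x a)
            (hC.mem_fire hdet hzC hx hxz) (hC'.mem_fire hdet hmC he hxm) hw
        · by_cases hxm : m = x
          -- The token advances in `C'` only. The outcome may differ from that of the run, so the
          -- induction on rank takes over with a new run.
          · subst hxm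
            have hr := G.rank_next m hm hf
            exact ih _ (hk ▸ hr) hC (hC'.fire he (G.outcome_mem hm hf))
              (hcov.fire_right hdet hC' he hx) (G.next_mem m hm hf) hzC
              (G.next_mem_fire hm hf) rfl (by omega)
          · exact ihw hC (hC'.fire he ha) (hcov.fire_right hdet hC' he hx) hzC
              (hC'.mem_fire hdet hmC he hxm) hw

/-- Two reachable configurations coincide if every node enabled in one of them is awaited by
some process in the other one. -/
theorem Covered.eq (hdet : D.Deterministic) (hsound : D.Sound) {C C' : P → Set N}
    (hC : D.Reachable C) (hC' : D.Reachable C') (h : D.Covered C C') (h' : D.Covered C' C) :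
    C = C' := by
  obtain ⟨w, hw⟩ := hC.exists_run hsound
  induction w generalizing C C' with
  | nil =>
    cases hw
    exact (Covered.eq_finConfig hdet hsound hC' h').symm
  | cons l w ih =>
    by_cases hf' : C = D.finConfig
    · subst hf'
      exact (Covered.eq_finConfig hdet hsound hC' h').symm
    cases hw with
    | @cons _ _ x a _ he ha hw =>
      have hf : x ≠ D.fin := by
        rintro rfl
        exact hf' (hC.eq_finConfig hdet he)
      by_cases hx : D.Enabled C' x
      · have heq := ih (hC.fire he ha) (hC'.fire hx ha) (h.fire x a) (h'.fire x a) hw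
        funext p
        by_cases hp : p ∈ D.dom x
        · ext m
          exact ⟨fun hm => hC.eq hdet hm (he p hp) ▸ hx p hp,
            fun hm => hC'.eq hdet hm (hx p hp) ▸ he p hp⟩
        · have := congrFun heq p
          rwa [fire_of_notMem hp, fire_of_notMem hp] at this
      -- Start a guide at `x` with the process that waits there in `C'`. Executing `x` in `C` alone
      -- puts the token ahead of the one in `C'`, although `C'` is covered.
      · obtain ⟨p, hp, hxp⟩ := h x he
        have : Nonempty R := ⟨a⟩
        obtain ⟨G, hG, rfl⟩ := hC.guided hdet hsound (he p hp) p hp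
        exact absurd (G.rank_next x hG hf) (G.not_rank_lt hdet hsound hC'
          (hC.fire he (G.outcome_mem hG hf)) (h'.fire_right hdet hC he hx) hG
          (G.next_mem x hG hf) hxp (G.next_mem_fire hG hf))

end Guides

/-! ### Existence and uniqueness of I(n) and F(n) -/

section Subnegotiation

variable {P N R : Type*} [Finite P] [Finite N] {D : NegotiationDiagram P N R} {n : N}
  {I F : P → Set N}

theorem exists_isFirst (hdet : D.Deterministic) (hsound : D.Sound) (hreach : D.ReachableNode n) :
    ∃ I, D.IsFirst n I := by
  obtain ⟨C, hC, he⟩ := hreach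
  obtain ⟨u, C', hu, huQ, hmax⟩ := hC.exists_exhaust hdet hsound {m | m ≠ n ∧ m ≠ D.fin}
    (fun h => h.2 rfl)
  have he' : D.Enabled C' n := hC.enabled_run hdet hu he fun l hl => (huQ l hl).1
  refine ⟨C', hC.run hu, fun m => ⟨fun hm => ?_, fun hm => hm ▸ he'⟩⟩
  by_contra hne
  by_cases hf : m = D.fin
  · subst hf
    obtain ⟨p, hp⟩ := D.dom_nonempty n
    exact hne ((hC.run hu).eq hdet (hm p (by simp [D.dom_fin])) (he' p hp))
  · exact hmax m ⟨hne, hf⟩ hm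

theorem IsFirst.eq (hdet : D.Deterministic) (hsound : D.Sound) {I' : P → Set N}
    (hI : D.IsFirst n I) (hI' : D.IsFirst n I') : I = I' := by
  obtain ⟨p, hp⟩ := D.dom_nonempty n
  refine Covered.eq hdet hsound hI.1 hI'.1 (fun y hy => ?_) fun y hy => ?_
  · obtain rfl := (hI.2 y).1 hy
    exact ⟨p, hp, (hI'.2 y).2 rfl p hp⟩
  · obtain rfl := (hI'.2 y).1 hy
    exact ⟨p, hp, (hI.2 y).2 rfl p hp⟩

theorem IsFirst.reachable (hI : D.IsFirst n I) {C : P → Set N} {u : List (N × R)}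
    (hu : D.Run I u C) : D.Reachable C := hI.1.run hu

/-- Every `n`-sequence from `I(n)` can be continued to some `F(n)`, without executing the final
node. -/
theorem IsFirst.exists_isLast (hdet : D.Deterministic) (hsound : D.Sound) (hI : D.IsFirst n I)
    {C : P → Set N} {u : List (N × R)} (hu : D.IsSeq n u) (hr : D.Run I u C) :
    ∃ v F, D.IsSeq n v ∧ D.Run C v F ∧ (∀ l ∈ v, l.1 ≠ D.fin) ∧ D.IsLast n I F := by
  obtain ⟨v, F, hv, hvQ, hmax⟩ := (hI.reachable hr).exists_exhaust hdet hsound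
    {m | D.dom m ⊆ D.dom n ∧ m ≠ D.fin} (fun h => h.2 rfl)
  exact ⟨v, F, fun l hl => (hvQ l hl).1, hv, fun l hl => (hvQ l hl).2,
    ⟨u ++ v, hu.append fun l hl => (hvQ l hl).1, hr.append hv⟩,
    fun m hm he hd => hmax m ⟨hd, hm⟩ he⟩

theorem IsLast.reachable (hI : D.IsFirst n I) (hF : D.IsLast n I F) : D.Reachable F := by
  obtain ⟨⟨u, -, hr⟩, -⟩ := hF
  exact hI.reachable hr

/-- A node with a process outside `dom n` that is enabled after an `n`-sequence is awaited after
any other `n`-sequence. -/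
theorem exists_mem_of_not_subset {C C' : P → Set N} {u v : List (N × R)} (hu : D.IsSeq n u)
    (hr : D.Run I u C) (hv : D.IsSeq n v) (hr' : D.Run I v C') {y : N} (hy : D.Enabled C y)
    (hd : ¬ D.dom y ⊆ D.dom n) : ∃ q ∈ D.dom y, y ∈ C' q := by
  obtain ⟨q, hq, hqn⟩ := Set.not_subset.1 hd
  refine ⟨q, hq, ?_⟩
  rw [hv.eq_of_notMem hr' hqn, ← hu.eq_of_notMem hr hqn]
  exact hy q hq

/-- An enabled node either has a process outside dom(n), still where it was in `I`, or is final; in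
the latter case dom(n) contains all processes and both configurations are final. -/
theorem IsLast.covered (hdet : D.Deterministic) (hsound : D.Sound) (hI : D.IsFirst n I)
    {F' : P → Set N} (hF : D.IsLast n I F) (hF' : D.IsLast n I F') : D.Covered F F' := by
  intro y hy
  by_cases hd : D.dom y ⊆ D.dom n
  · have hyf : y = D.fin := by
      by_contra h
      exact hF.2 y h hy hd
    subst hyf
    have hF'fin : F' = D.finConfig := by
      by_contra h
      obtain ⟨m, hm, he⟩ := (hF'.reachable hI).exists_enabled hdet hsound h
      exact hF'.2 m hm he ((by simp [D.dom_fin] : D.dom m ⊆ D.dom D.fin).trans hd)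
    obtain ⟨q, hq⟩ := D.dom_nonempty D.fin
    exact ⟨q, hq, by rw [hF'fin]; rfl⟩
  · obtain ⟨⟨u, hu, hr⟩, -⟩ := hF
    obtain ⟨⟨v, hv, hr'⟩, -⟩ := hF'
    exact exists_mem_of_not_subset hu hr hv hr' hy hd

theorem IsLast.eq (hdet : D.Deterministic) (hsound : D.Sound) (hI : D.IsFirst n I)
    {F' : P → Set N} (hF : D.IsLast n I F) (hF' : D.IsLast n I F') : F = F' :=
  Covered.eq hdet hsound (hF.reachable hI) (hF'.reachable hI)
    (hF.covered hdet hsound hI hF') (hF'.covered hdet hsound hI hF)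

/-- In `F(n)`, no process waits at a node that is executed in some `n`-sequence. -/
theorem IsLast.notMem (hdet : D.Deterministic) (hsound : D.Sound) (hI : D.IsFirst n I)
    (hF : D.IsLast n I F) {C : P → Set N} {u : List (N × R)} (hu : D.IsSeq n u)
    (hr : D.Run I u C) {m : N} (hm : D.Enabled C m) (hmf : m ≠ D.fin)
    (hmn : D.dom m ⊆ D.dom n) {p : P} (hp : p ∈ D.dom m) : m ∉ F p := by
  intro hmF
  have hC := hI.reachable hr
  -- Keeping `m` back, exhaust the other nodes inside dom(n). If `m` were awaited in `F`, then `C'`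
  -- and `F` would cover each other, yet `C'` enables `m`.
  obtain ⟨v, C', hv, hvQ, hmax⟩ := hC.exists_exhaust hdet hsound
    {x | D.dom x ⊆ D.dom n ∧ x ≠ D.fin ∧ x ≠ m} (fun h => h.2.1 rfl)
  have hC' := hC.run hv
  have hmC' : D.Enabled C' m := hC.enabled_run hdet hv hm fun l hl => (hvQ l hl).2.2
  have huv : D.IsSeq n (u ++ v) := hu.append fun l hl => (hvQ l hl).1
  have hFr := hF.reachable hI
  obtain ⟨⟨t, ht, hrt⟩, hFmax⟩ := hF
  have heq : C' = F := by
    refine Covered.eq hdet hsound hC' hFr (fun y hy => ?_) fun y hy => ?_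
    · by_cases hd : D.dom y ⊆ D.dom n
      · have hym : y = m := by
          by_contra hne
          refine hmax y ⟨hd, ?_, hne⟩ hy
          rintro rfl
          exact hne (hC'.eq hdet (hy p (by simp [D.dom_fin])) (hmC' p hp))
        subst hym
        exact ⟨p, hp, hmF⟩
      · exact exists_mem_of_not_subset huv (hr.append hv) ht hrt hy hd
    · by_cases hd : D.dom y ⊆ D.dom n
      · have hyf : y = D.fin := by
          by_contra h
          exact hFmax y h hy hd
        subst hyf
        exact absurd (hFr.eq hdet hmF (hy p (by simp [D.dom_fin]))) hmf
      · exact exists_mem_of_not_subset ht hrt huv (hr.append hv) hy hd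
  subst heq
  exact hFmax m hmf hmC' hmn

/-! ### Determinism and soundness of the subnegotiation -/

theorem subnegotiation_deterministic (hdet : D.Deterministic) (hn : n ≠ D.fin)
    (hI : D.IsFirst n I) (hF : D.IsLast n I F) :
    (D.subnegotiation n I F hn hI hF).Deterministic := by
  rintro (_ | m) a p
  · exact Or.inl rfl
  · apply Set.Subsingleton.eq_empty_or_singleton
    rintro k ⟨-, -, h⟩ k' ⟨-, -, h'⟩
    rcases h with ⟨hne, x, rfl, hx⟩ | ⟨heq, rfl⟩ <;>
      rcases h' with ⟨hne', x', rfl, hx'⟩ | ⟨heq', rfl⟩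
    · rcases hdet m.1 a p.1 with h0 | ⟨y, hy⟩
      · simp [h0] at hx
      · rw [hy] at hx hx'
        rw [Subtype.ext (hx.trans hx'.symm)]
    · exact absurd heq' hne
    · exact absurd heq hne'
    · rfl

open Classical in
/-- The configuration of `D|_n` that corresponds to a configuration of `D`. -/
noncomputable def restrictConfig (D : NegotiationDiagram P N R) (n : N) (I F C : P → Set N) :
    {p : P // p ∈ D.dom n} → Set (Option {m : N // m ∈ D.subNodes n I F}) :=
  fun p => if C p.1 = F p.1 then {none} else {k | ∃ m, k = some m ∧ m.1 ∈ C p.1}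

theorem some_mem_restrictConfig {C : P → Set N} {p : {p : P // p ∈ D.dom n}}
    {m : {m : N // m ∈ D.subNodes n I F}} :
    some m ∈ D.restrictConfig n I F C p ↔ C p.1 ≠ F p.1 ∧ m.1 ∈ C p.1 := by
  unfold restrictConfig
  split_ifs with h <;> simp [h]

/-- Redirected transitions and restricted configurations use the same comparison with `F`, so
restriction commutes with execution. -/
theorem restrictConfig_fire (hn : n ≠ D.fin) (hI : D.IsFirst n I) (hF : D.IsLast n I F)
    (C : P → Set N) {m : {m : N // m ∈ D.subNodes n I F}} {a : R}
    (hl : (m.1, a) ∈ D.subLocs n I F) :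
    (D.subnegotiation n I F hn hI hF).fire (D.restrictConfig n I F C) (some m) a =
      D.restrictConfig n I F (D.fire C m.1 a) := by
  funext p
  by_cases hp : p.1 ∈ D.dom m.1
  · have hp' : p ∈ (D.subnegotiation n I F hn hI hF).dom (some m) := hp
    rw [fire_of_mem hp', restrictConfig, fire_of_mem hp]
    ext k
    change ((m.1, a) ∈ D.subLocs n I F ∧ p.1 ∈ D.dom m.1 ∧ _) ↔ _
    by_cases h : D.trans m.1 a p.1 = F p.1 <;> simp [h, hl, hp]
  · have hp' : p ∉ (D.subnegotiation n I F hn hI hF).dom (some m) := hp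
    rw [fire_of_notMem hp', restrictConfig, restrictConfig, fire_of_notMem hp]

theorem restrictConfig_last (hn : n ≠ D.fin) (hI : D.IsFirst n I) (hF : D.IsLast n I F) :
    D.restrictConfig n I F F = (D.subnegotiation n I F hn hI hF).finConfig := by
  funext p
  simp [restrictConfig, finConfig, subnegotiation]

theorem restrictConfig_first (hdet : D.Deterministic) (hsound : D.Sound) (hn : n ≠ D.fin)
    (hI : D.IsFirst n I) (hF : D.IsLast n I F) :
    D.restrictConfig n I F I = (D.subnegotiation n I F hn hI hF).initConfig := by
  funext p
  have hIn : D.Enabled I n := (hI.2 n).2 rfl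
  have hnF : n ∉ F p.1 :=
    hF.notMem hdet hsound hI (u := []) (by simp [IsSeq]) (.nil I) hIn hn subset_rfl p.2
  have hnI := hIn p.1 p.2
  have hne : I p.1 ≠ F p.1 := fun h => hnF (h ▸ hnI)
  ext k
  rcases k with _ | k
  · simp [restrictConfig, hne, initConfig, subnegotiation]
  · rw [some_mem_restrictConfig]
    simp only [initConfig, subnegotiation, Set.mem_singleton_iff, Option.some.injEq]
    constructor
    · rintro ⟨-, hk⟩
      exact Subtype.ext (hI.1.eq hdet hk hnI)
    · rintro rfl
      exact ⟨hne, hnI⟩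

/-- Runs of `D|_n` come from `n`-sequences of `D`. -/
theorem Run.of_subnegotiation (hn : n ≠ D.fin) (hI : D.IsFirst n I) (hF : D.IsLast n I F)
    {w : List (Option {m : N // m ∈ D.subNodes n I F} × R)}
    {S S' : {p : P // p ∈ D.dom n} → Set (Option {m : N // m ∈ D.subNodes n I F})}
    (h : (D.subnegotiation n I F hn hI hF).Run S w S') {C : P → Set N}
    (hS : S = D.restrictConfig n I F C) :
    ∃ u C', D.IsSeq n u ∧ D.Run C u C' ∧ S' = D.restrictConfig n I F C' := by
  induction h generalizing C with
  | nil => exact ⟨[], C, by simp [IsSeq], .nil C, hS⟩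
  | @cons S S' m a w he ha _ ih =>
    subst hS
    rcases m with _ | m
    · exact ha.elim
    have hl : (m.1, a) ∈ D.subLocs n I F := ha
    obtain ⟨u, C', hu, hr, hS'⟩ := ih (restrictConfig_fire hn hI hF C hl)
    obtain ⟨t, ht, hrt, hmem⟩ := hl
    have hd : D.dom m.1 ⊆ D.dom n := ht _ hmem
    refine ⟨(m.1, a) :: u, C', ?_, .cons (fun p hp => ?_) (hrt.mem_out hmem) hr, hS'⟩
    · intro l hl
      rcases List.mem_cons.1 hl with rfl | hl
      · exact hd
      · exact hu l hl
    · exact (some_mem_restrictConfig.1 (he ⟨p, hd hp⟩ hp)).2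

/-- The `n`-sequences of `D` that lead to `F(n)` without executing the final node give runs of
`D|_n`. -/
theorem Run.exists_subnegotiation (hdet : D.Deterministic) (hsound : D.Sound) (hn : n ≠ D.fin)
    (hI : D.IsFirst n I) (hF : D.IsLast n I F) {C C' : P → Set N} {v : List (N × R)}
    (h : D.Run C v C') (hv : D.IsSeq n v) (hvf : ∀ l ∈ v, l.1 ≠ D.fin)
    {u : List (N × R)} (hu : D.IsSeq n u) (hr : D.Run I u C) (hC' : C' = F) :
    ∃ w, (D.subnegotiation n I F hn hI hF).Run (D.restrictConfig n I F C) w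
      (D.restrictConfig n I F C') := by
  induction h generalizing u with
  | nil => exact ⟨[], .nil _⟩
  | @cons C C' m a v he ha hrun ih =>
    have hd : D.dom m ⊆ D.dom n := hv _ List.mem_cons_self
    have hmf : m ≠ D.fin := hvf _ List.mem_cons_self
    have hl : (m, a) ∈ D.subLocs n I F :=
      ⟨u ++ (m, a) :: v, hu.append hv, hC' ▸ hr.append (.cons he ha hrun), by simp⟩
    obtain ⟨w, hw⟩ := ih (fun l hl => hv l (List.mem_cons_of_mem _ hl))
      (fun l hl => hvf l (List.mem_cons_of_mem _ hl))
      (hu.append (v := [(m, a)]) (by simpa [IsSeq] using hd))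
      (hr.append (Run.single he ha)) hC'
    have hm : m ∈ D.subNodes n I F := ⟨a, hl⟩
    rw [← restrictConfig_fire hn hI hF C (m := ⟨m, hm⟩) hl] at hw
    refine ⟨(some ⟨m, hm⟩, a) :: w, .cons (fun p hp => ?_) hl hw⟩
    have hmC := he p.1 hp
    -- No process about to execute `m` counts as finished. This can fail for the final node, which
    -- is why `v` avoids it.
    exact some_mem_restrictConfig.2
      ⟨fun h => hF.notMem hdet hsound hI hu hr he hmf hd hp (h ▸ hmC), hmC⟩

theorem subnegotiation_sound (hdet : D.Deterministic) (hsound : D.Sound) (hn : n ≠ D.fin)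
    (hI : D.IsFirst n I) (hF : D.IsLast n I F) :
    (D.subnegotiation n I F hn hI hF).Sound := by
  intro w S hw
  obtain ⟨u, C, hu, hr, rfl⟩ :=
    Run.of_subnegotiation hn hI hF hw (restrictConfig_first hdet hsound hn hI hF).symm
  obtain ⟨v, F', hv, hrv, hvf, hF'⟩ := hI.exists_isLast hdet hsound hu hr
  obtain ⟨w', hw'⟩ := hrv.exists_subnegotiation hdet hsound hn hI hF hv hvf hu hr
    (hF'.eq hdet hsound hI hF)
  rw [hF'.eq hdet hsound hI hF, restrictConfig_last hn hI hF] at hw'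
  exact ⟨w', hw.append hw'⟩

end Subnegotiation

end NegotiationDiagram

theorem mainTheorem3 {P N R : Type*} [Finite P] [Finite N] (D : NegotiationDiagram P N R)
    (hdet : D.Deterministic) (hsound : D.Sound)
    (n : N) (hreach : D.ReachableNode n) (hn : n ≠ D.fin) :
    (∃! I : P → Set N, D.IsFirst n I) ∧
    (∀ I : P → Set N, D.IsFirst n I → ∃! F : P → Set N, D.IsLast n I F) ∧
    (∀ (I F : P → Set N) (hI : D.IsFirst n I) (hF : D.IsLast n I F),
      (D.subnegotiation n I F hn hI hF).Deterministic ∧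
      (D.subnegotiation n I F hn hI hF).Sound) := by
  refine ⟨?_, fun I hI => ?_, fun I F hI hF =>
    ⟨NegotiationDiagram.subnegotiation_deterministic hdet hn hI hF,
      NegotiationDiagram.subnegotiation_sound hdet hsound hn hI hF⟩⟩
  · obtain ⟨I, hI⟩ := NegotiationDiagram.exists_isFirst hdet hsound hreach
    exact ⟨I, hI, fun I' hI' => hI'.eq hdet hsound hI⟩
  · obtain ⟨-, F, -, -, -, hF⟩ :=
      hI.exists_isLast hdet hsound (u := []) (by simp [NegotiationDiagram.IsSeq]) (.nil I)
    exact ⟨F, hF, fun F' hF' => hF'.eq hdet hsound hI hF⟩
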